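/- Let $\mathbb N=\{1,2,\dots\}$. Fix constants $\theta\ge 1$, $N\ge 1$, $\nu>0$, $K>0$, $a>0$. Then there exists $c_0>0$, depending only on these constants, with the following property. Let $X=(X,\|\cdot\|)$ be a (real or complex) Banach space, and let $\mu=(\mu_n)_{n\ge 0}$ be a positive, strictly increasing sequence with $\mu_0=1$, $\mu_n\to+\infty$ and $\mu_{n+1}/\mu_n\le\theta$ for all $n\ge 0$. Let $(\|\cdot\|_n)_{n\in\mathbb N}$ be norms on $X$, each of them equivalent to $\|\cdot\|$ (the equivalence constants may depend on $n$). Let $(A_n)_{n\in\mathbb N}$ be bounded invertible linear operators on $X$, and put $\Phi_A(m,k)=A_{m-1}\cdots A_k$ for $m>k$, $\Phi_A(k,k)=\mathrm{Id}$, and $\Phi_A(m,k)=\Phi_A(k,m)^{-1}$ for $m<k$. Assume the following. 1. ($\mu$-dichotomy) There are projections $(P_k)_{k\in\mathbb N}$ on $X$ such that $A_kP_k=P_{k+1}A_k$ and $A_k|_{\operatorname{Ker}P_k}\colon\operatorname{Ker}P_k\to\operatorname{Ker}P_{k+1}$ is an isomorphism for all $k\in\mathbb N$, and such that for all $x\in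 X$ $$\|\Phi_A(m,k)P_kx\|_m\le N\Big(\frac{\mu_m}{\mu_k}\Big)^{-\nu}\|x\|_k\quad(m\ge k\ge 1),\qquad \|\Phi_A(m,k)(\mathrm{Id}-P_k)x\|_m\le N\Big(\frac{\mu_k}{\mu_m}\Big)^{-\nu}\|x\|_k\quad(1\le m\le k).$$ 2. ($\mu$-bounded growth) For all $x\in X$, $\|\Phi_A(m,k)x\|_m\le K(\mu_m/\mu_k)^a\|x\|_k$ for $m\ge k\ge 1$ and $\|\Phi_A(m,k)x\|_m\le K(\mu_k/\mu_m)^a\|x\|_k$ for $1\le m\le k$. 3. $g_n\colon X\to X$, $n\in\mathbb N$, are maps for which there are $M>0$ and $0<c\le c_0$ such that, for all $n\in\mathbb N$ and $x,y\in X$, $$\|g_n(x)\|_{n+1}\le M\,\frac{\mu_{n+1}-\mu_n}{\mu_n},\qquad \|g_n(x)-g_n(y)\|_{n+1}\le c\,\frac{\mu_{n+1}-\mu_n}{\mu_n}\,\|x-y\|_n.$$ Then there exist homeomorphisms $h_n\colon X\to X$, $n\in\mathbb N$, such that: (i) $h_{n+1}\circ(A_n+g_n)=A_n\circ h_n$ for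 all $n\in\mathbb N$; (ii) there is $D>0$ such that $\|h_n(x)-x\|_n\le D$ and $\|h_n^{-1}(x)-x\|_n\le D$ for all $n\in\mathbb N$ and $x\in X$; (iii) there are $\bar K,\varrho,\delta>0$ such that $\|h_n(x)-h_n(y)\|_n\le\bar K\|x-y\|_n^{\varrho}$ and $\|h_n^{-1}(x)-h_n^{-1}(y)\|_n\le\bar K\|x-y\|_n^{\varrho}$ for all $n\in\mathbb N$ and all $x,y\in X$ with $\|x-y\|_n\le\delta$. -/

import Mathlib

open Filter

/-- A discrete growth rate `μ = (μ_n)_{n ≥ 0}`: positive, strictly increasing, `μ_0 = 1`,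
`μ_n → ∞`. -/
structure IsGrowthRate (μ : ℕ → ℝ) : Prop where
  pos : ∀ n, 0 < μ n
  strictMono : StrictMono μ
  tendsto : Tendsto μ atTop atTop
  zero : μ 0 = 1

section

variable {𝕜 X : Type*} [RCLike 𝕜] [NormedAddCommGroup X] [NormedSpace 𝕜 X]

/-- `p` is a norm on `X` equivalent to the given one. -/
def IsEquivalentNorm (p : Seminorm 𝕜 X) : Prop :=
  ∃ b B : ℝ, 0 < b ∧ 0 < B ∧ ∀ x : X, b * ‖x‖ ≤ p x ∧ p x ≤ B * ‖x‖

/-- `forwardEvolution A k j = A_{k+j-1} ⋯ A_k`, the product of `j` factors. -/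
def forwardEvolution (A : ℕ → X →L[𝕜] X) (k : ℕ) : ℕ → (X →L[𝕜] X)
  | 0 => ContinuousLinearMap.id 𝕜 X
  | j + 1 => (A (k + j)).comp (forwardEvolution A k j)

/-- The evolution family `Φ_A(m, k)`: it is `A_{m-1} ⋯ A_k` for `m ≥ k` (the identity when
`m = k`), and the inverse of `Φ_A(k, m)` for `m < k` (used for invertible operators only). -/
noncomputable def evolution (A : ℕ → X →L[𝕜] X) (m k : ℕ) : X →L[𝕜] X :=
  if k ≤ m then forwardEvolution A k (m - k) else (forwardEvolution A m (k - m)).inverse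

/-- The system `x_{n+1} = A_n x_n`, `n ≥ 1`, admits a `μ`-dichotomy with respect to the norms
`p_k`, `k ≥ 1`, with constants `N` and `ν` and projections `P_k`, `k ≥ 1`.
The operators need not be invertible: for `m ≤ k`, the operator `Φ_A(m, k)` in the last condition
is the inverse of the bijection `Φ_A(k, m) : Ker P_m → Ker P_k`, so that
`y = Φ_A(m, k) (x - P_k x)` is the unique `y ∈ Ker P_m` with `Φ_A(k, m) y = x - P_k x`. -/
structure IsMuDichotomy (μ : ℕ → ℝ) (p : ℕ → Seminorm 𝕜 X) (A : ℕ → X →L[𝕜] X)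
    (N ν : ℝ) (P : ℕ → X →L[𝕜] X) : Prop where
  proj : ∀ k, 1 ≤ k → ∀ x, P k (P k x) = P k x
  commute : ∀ k, 1 ≤ k → ∀ x, A k (P k x) = P (k + 1) (A k x)
  bijOn_ker : ∀ k, 1 ≤ k → Set.BijOn (A k) {x | P k x = 0} {x | P (k + 1) x = 0}
  stable : ∀ m k, 1 ≤ k → k ≤ m → ∀ x,
    p m (evolution A m k (P k x)) ≤ N * (μ m / μ k) ^ (-ν) * p k x
  unstable : ∀ m k, 1 ≤ m → m ≤ k → ∀ x y, P m y = 0 → evolution A k m y = x - P k x →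
    p m y ≤ N * (μ k / μ m) ^ (-ν) * p k x

/-- `μ`-bounded growth, forwards and backwards in time, with respect to the norms `p_k`, for a
system of invertible operators, with constants `K` and `a`. -/
def HasMuBoundedGrowth (μ : ℕ → ℝ) (p : ℕ → Seminorm 𝕜 X) (A : ℕ → X →L[𝕜] X)
    (K a : ℝ) : Prop :=
  (∀ m k, 1 ≤ k → k ≤ m → ∀ x, p m (evolution A m k x) ≤ K * (μ m / μ k) ^ a * p k x) ∧
  (∀ m k, 1 ≤ m → m ≤ k → ∀ x, p m (evolution A m k x) ≤ K * (μ k / μ m) ^ a * p k x)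

end

/-! ### Equivalent norms, contractions and Lipschitz perturbations of isomorphisms. -/

section EquivalentNorm

variable {𝕜 X : Type*} [RCLike 𝕜] [NormedAddCommGroup X] [NormedSpace 𝕜 X]

/-! In the logarithmic time `ℓ n = log (μ (n + 1))` the dichotomy and growth bounds become
exponentials of `|ℓ m - ℓ k|`, and the weight on `g` becomes `exp (ℓ (n + 1) - ℓ n) - 1`. Since the
steps of `ℓ` are at most `log θ`, summing this weight against `exp (-β * |ℓ m - ℓ (j + 1)|)` is like
integrating `exp (-β * |t|)`, so the sum is bounded uniformly (`tsum_exp_mul_le`). Hence the Green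
operator turns a forcing of the size of `g` into a bounded solution of `w (n + 1) = A n (w n) + f n`
(`IsHyperbolicSystem.greenSum_le`, `greenSum_succ`).

The conjugacy subtracts from an orbit of the nonlinear system the Green sum of `g` along it: the
forcing cancels and a linear orbit remains. Conversely, a linear orbit `y` is corrected by the fixed
point `w` of `w = greenSum (g (y + w))`, a contraction for small `c`. On a half-line bounded
solutions are not unique, so it is uniqueness of this fixed point, not of bounded solutions, that
makes one of the two compositions the identity; the other follows from the fixed point equation
itself.

For Hölder continuity, a discrete Gronwall inequality shows that orbits separate at most like `exp
((a + 1) * |ℓ j - ℓ n|)`. Interpolating between the bound `2 * M` and the Lipschitz bound on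
differences of `g` reduces this rate to `ρ * (a + 1)`, and for `ρ * (a + 1) ≤ ν / 2` the Green sum
still converges with that weight. -/

theorem IsEquivalentNorm.continuous {p : Seminorm 𝕜 X} (hp : IsEquivalentNorm p) :
    Continuous p := by
  obtain ⟨b, B, hb, hB, h⟩ := hp
  refine Seminorm.continuous_of_le (p := p) (q := (B.toNNReal) • normSeminorm 𝕜 X) ?_ ?_
  · exact (continuous_norm.const_smul B.toNNReal)
  · intro x
    have := (h x).2
    simpa [NNReal.smul_def, hB.le] using this

theorem Seminorm.sum_le (p : Seminorm 𝕜 X) {ι : Type*} (s : Finset ι) (f : ι → X) :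
    p (∑ i ∈ s, f i) ≤ ∑ i ∈ s, p (f i) :=
  Finset.le_sum_of_subadditive p (map_zero p).le (map_add_le_add p) s f

theorem IsEquivalentNorm.eq_zero {p : Seminorm 𝕜 X} (hp : IsEquivalentNorm p) {x : X}
    (hx : p x ≤ 0) : x = 0 := by
  obtain ⟨b, B, hb, hB, h⟩ := hp
  have h1 := (h x).1
  have : ‖x‖ ≤ 0 := by
    by_contra! h2
    nlinarith [mul_pos hb h2]
  exact norm_le_zero_iff.1 this

theorem IsEquivalentNorm.summable [CompleteSpace X] {p : Seminorm 𝕜 X} (hp : IsEquivalentNorm p)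
    {ι : Type*} {f : ι → X} {u : ι → ℝ} (hu : Summable u) (h : ∀ i, p (f i) ≤ u i) :
    Summable f := by
  obtain ⟨b, B, hb, hB, hbB⟩ := hp
  refine Summable.of_norm_bounded (g := fun i => b⁻¹ * u i) (hu.mul_left _) fun i => ?_
  rw [inv_mul_eq_div, le_div_iff₀ hb, mul_comm]
  exact (hbB _).1.trans (h i)

theorem IsEquivalentNorm.tsum_le [CompleteSpace X] {p : Seminorm 𝕜 X} (hp : IsEquivalentNorm p)
    {ι : Type*} {f : ι → X} {u : ι → ℝ} (hu : Summable u) (h : ∀ i, p (f i) ≤ u i) :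
    p (∑' i, f i) ≤ ∑' i, u i := by
  have hf := (hp.summable hu h).hasSum
  refine le_of_tendsto_of_tendsto ((hp.continuous.tendsto _).comp hf) hu.hasSum ?_
  refine Eventually.of_forall fun s => ?_
  refine (p.sum_le s f).trans (Finset.sum_le_sum fun i _ => h i)

/-- The contraction principle for families `w : ι → X` bounded with respect to the norms `p i`. -/
theorem exists_fixedPoint_of_contraction [CompleteSpace X] {ι : Type*} {p : ι → Seminorm 𝕜 X}
    (hp : ∀ i, IsEquivalentNorm (p i)) {T : (ι → X) → ι → X} {q B : ℝ} (hq : 0 ≤ q) (hq1 : q < 1)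
    (hT : ∀ w w' C, 0 ≤ C → (∀ i, p i (w i - w' i) ≤ C) → ∀ i, p i (T w i - T w' i) ≤ q * C)
    (hB : 0 ≤ B) (hT0 : ∀ i, p i (T 0 i) ≤ B) : ∃ w, T w = w := by
  let s : ℕ → ι → X := fun k => T^[k] 0
  have hs : ∀ k, s (k + 1) = T (s k) := fun k => Function.iterate_succ_apply' T k 0
  have hstep : ∀ k i, p i (s (k + 1) i - s k i) ≤ B * q ^ k := by
    intro k
    induction k with
    | zero => intro i; simpa [s] using hT0 i
    | succ k ih =>
      intro i
      rw [hs (k + 1), hs k, ← hs k]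
      have := hT (s (k + 1)) (s k) (B * q ^ k) (by positivity) ih i
      rw [← hs k] at this
      refine this.trans (le_of_eq (by ring))
  have hgeo : Summable fun k : ℕ => B * q ^ k := (summable_geometric_of_lt_one hq hq1).mul_left B
  have hsum : ∀ i, Summable fun k => s (k + 1) i - s k i := fun i =>
    (hp i).summable hgeo fun k => hstep k i
  have hlim : ∀ i, ∃ x, Tendsto (fun k => s k i) atTop (nhds x) := by
    intro i
    refine ⟨_, ((hsum i).hasSum.tendsto_sum_nat).congr fun k => ?_⟩
    rw [Finset.sum_range_sub (fun k => s k i)]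
    simp [s]
  choose w hw using hlim
  have hfar : ∀ k l i, p i (s (k + l) i - s k i) ≤ B * q ^ k * (1 - q)⁻¹ := by
    intro k l i
    have h1 : s (k + l) i - s k i = ∑ j ∈ Finset.range l, (s (k + j + 1) i - s (k + j) i) := by
      simpa [add_assoc] using (Finset.sum_range_sub (fun j => s (k + j) i) l).symm
    rw [h1]
    refine ((p i).sum_le _ _).trans ?_
    refine (Finset.sum_le_sum fun j _ => hstep (k + j) i).trans ?_
    simp_rw [pow_add, ← mul_assoc]
    rw [← Finset.mul_sum, ← tsum_geometric_of_lt_one hq hq1]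
    refine mul_le_mul_of_nonneg_left ?_ (by positivity)
    exact (summable_geometric_of_lt_one hq hq1).sum_le_tsum _ fun j _ => by positivity
  have hdist : ∀ k i, p i (w i - s k i) ≤ B * q ^ k * (1 - q)⁻¹ := by
    intro k i
    have h1 : Tendsto (fun l => p i (s (k + l) i - s k i)) atTop (nhds (p i (w i - s k i))) := by
      refine ((hp i).continuous.tendsto _).comp ?_
      have := (hw i).comp (tendsto_add_atTop_nat k)
      refine Tendsto.sub_const (this.congr fun l => ?_) _
      simp [add_comm]
    exact le_of_tendsto' h1 fun l => hfar k l i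
  refine ⟨w, funext fun i => ?_⟩
  rw [← sub_eq_zero]
  refine (hp i).eq_zero ?_
  -- The factor 2 covers the distances from `s (k + 1)` to `T w` and to `w`.
  have h0 : Tendsto (fun k : ℕ => 2 * (B * q ^ (k + 1) * (1 - q)⁻¹)) atTop (nhds 0) := by
    have := ((tendsto_pow_atTop_nhds_zero_of_lt_one hq hq1).comp (tendsto_add_atTop_nat 1))
    simpa using ((this.const_mul B).mul_const ((1 - q)⁻¹)).const_mul 2
  refine ge_of_tendsto' h0 fun k => ?_
  have hq1' : 0 < 1 - q := by linarith
  have h1 := hT w (s k) _ (by positivity) (hdist k) i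
  have h2 := hdist (k + 1) i
  rw [← hs k] at h1
  have h3 : T w i - w i = (T w i - s (k + 1) i) - (w i - s (k + 1) i) := by abel
  rw [h3]
  refine (map_sub_le_add (p i) _ _).trans ((add_le_add h1 h2).trans (le_of_eq ?_))
  ring

/-- A perturbation of an invertible operator by a map of small Lipschitz constant is bijective. -/
theorem bijective_add_of_contraction [CompleteSpace X] {p q : Seminorm 𝕜 X}
    (hp : IsEquivalentNorm p) (A : X ≃L[𝕜] X) {g : X → X} {κ ε : ℝ} (hκ : 0 ≤ κ) (hε : 0 ≤ ε)
    (hκε : κ * ε < 1) (hA : ∀ x, p (A.symm x) ≤ κ * q x)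
    (hg : ∀ x y, q (g x - g y) ≤ ε * p (x - y)) :
    Function.Bijective fun x => A x + g x := by
  have key : ∀ x y, p (A.symm (g x) - A.symm (g y)) ≤ κ * ε * p (x - y) := by
    intro x y
    rw [← map_sub, mul_assoc]
    exact (hA _).trans (mul_le_mul_of_nonneg_left (hg x y) hκ)
  constructor
  · intro x y hxy
    have hxy : A x + g x = A y + g y := hxy
    have h1 : x - y = -(A.symm (g x) - A.symm (g y)) := by
      have h2 : A.symm (A x + g x) = A.symm (A y + g y) := by rw [hxy]
      simp only [map_add, ContinuousLinearEquiv.symm_apply_apply] at h2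
      rw [neg_sub, sub_eq_sub_iff_add_eq_add, h2, add_comm]
    have h3 : p (x - y) ≤ κ * ε * p (x - y) := by
      conv_lhs => rw [h1, map_neg_eq_map]
      exact key x y
    have h4 : p (x - y) ≤ 0 := by
      by_contra! h
      nlinarith
    exact sub_eq_zero.1 (hp.eq_zero h4)
  · intro y
    obtain ⟨w, hw⟩ := exists_fixedPoint_of_contraction (ι := Unit) (p := fun _ => p)
      (fun _ => hp) (T := fun w i => A.symm (y - g (w i))) (q := κ * ε)
      (B := p (A.symm (y - g 0))) (by positivity) hκε
      (fun w w' C hC h i => by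
        have h1 : A.symm (y - g (w i)) - A.symm (y - g (w' i))
            = -(A.symm (g (w i)) - A.symm (g (w' i))) := by
          simp only [map_sub]; abel
        rw [h1, map_neg_eq_map]
        exact (key _ _).trans (mul_le_mul_of_nonneg_left (h i) (by positivity)))
      (apply_nonneg _ _) (fun i => le_rfl)
    refine ⟨w (), ?_⟩
    have h1 := congrFun hw ()
    have h2 : A (w ()) = y - g (w ()) := by
      conv_lhs => rw [← h1]
      simp
    simp [h2]

end EquivalentNorm

/-! ### Exponential sums, discrete Gronwall inequalities and interpolation. -/

section RealEstimates

open Real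

theorem exp_sub_one_le_mul_exp (d : ℝ) : exp d - 1 ≤ d * exp d := by
  have h := add_one_le_exp (-d)
  have h2 : exp d * exp (-d) = 1 := by rw [← exp_add]; simp
  nlinarith [exp_pos d]

/-- Comparison of `∑ e^{-β|ℓ_m - ℓ_{j+1}|} (e^{ℓ_{j+1} - ℓ_j} - 1)` with a telescoping sum. -/
theorem sum_range_exp_mul_le {ℓ : ℕ → ℝ} (hℓ : Monotone ℓ) {L : ℝ}
    (hL : ∀ n, ℓ (n + 1) - ℓ n ≤ L) {β : ℝ} (hβ : 0 < β) (m n : ℕ) :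
    ∑ j ∈ Finset.range n, exp (-β * |ℓ m - ℓ (j + 1)|) * (exp (ℓ (j + 1) - ℓ j) - 1)
      ≤ 2 * exp ((β + 1) * L) / β := by
  -- `E` samples the primitive of `β * exp (-β * |ℓ m - t|)` that vanishes at `-∞` and tends to 2 at
  -- `+∞`; its increments dominate the terms up to a constant.
  set E : ℕ → ℝ := fun j =>
    if j ≤ m then exp (-β * (ℓ m - ℓ j)) else 2 - exp (-β * (ℓ j - ℓ m)) with hE
  have hE0 : ∀ j, 0 ≤ E j := by
    intro j
    simp only [hE]
    split_ifs with h
    · positivity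
    · have : exp (-β * (ℓ j - ℓ m)) ≤ 1 := by
        apply exp_le_one_iff.2
        nlinarith [hℓ (le_of_not_ge h)]
      linarith
  have hE2 : ∀ j, E j ≤ 2 := by
    intro j
    simp only [hE]
    split_ifs with h
    · have : exp (-β * (ℓ m - ℓ j)) ≤ 1 := by
        apply exp_le_one_iff.2
        nlinarith [hℓ h]
      linarith
    · linarith [exp_pos (-β * (ℓ j - ℓ m))]
  have hterm : ∀ j, exp (-β * |ℓ m - ℓ (j + 1)|) * (exp (ℓ (j + 1) - ℓ j) - 1)
      ≤ exp ((β + 1) * L) / β * (E (j + 1) - E j) := by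
    intro j
    set d := ℓ (j + 1) - ℓ j with hd
    have hd0 : 0 ≤ d := sub_nonneg.2 (hℓ (Nat.le_succ j))
    have hdL : d ≤ L := hL j
    have h1 : exp d - 1 ≤ d * exp L :=
      (exp_sub_one_le_mul_exp d).trans (mul_le_mul_of_nonneg_left (exp_le_exp.2 hdL) hd0)
    have hL0 : 0 ≤ L := hd0.trans hdL
    have h2 : exp (-β * |ℓ m - ℓ (j + 1)|) * (β * d) ≤ exp (β * L) * (E (j + 1) - E j) := by
      simp only [hE]
      rcases lt_or_ge j m with hjm | hjm
      · rw [if_pos (Nat.succ_le_of_lt hjm), if_pos hjm.le,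
          abs_of_nonneg (sub_nonneg.2 (hℓ (Nat.succ_le_of_lt hjm)))]
        have h3 : exp (-β * (ℓ m - ℓ j)) = exp (-β * (ℓ m - ℓ (j + 1))) * exp (-(β * d)) := by
          rw [← exp_add, hd]; congr 1; ring
        rw [h3]
        have h4 := exp_sub_one_le_mul_exp (-(β * d))
        have h5 : exp (β * d) * exp (-(β * d)) = 1 := by rw [← exp_add]; simp
        have h6 : exp (β * d) ≤ exp (β * L) := exp_le_exp.2 (by nlinarith)
        have h7 : exp (-(β * d)) ≤ 1 := exp_le_one_iff.2 (by nlinarith)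
        have h8 : β * d ≤ exp (β * d) * (1 - exp (-(β * d))) := by
          have := add_one_le_exp (β * d); linarith
        have h9 : β * d ≤ exp (β * L) * (1 - exp (-(β * d))) :=
          h8.trans (mul_le_mul_of_nonneg_right h6 (by linarith))
        have := mul_le_mul_of_nonneg_left h9 (exp_pos (-β * (ℓ m - ℓ (j + 1)))).le
        linarith
      · have hm1 : ℓ m ≤ ℓ (j + 1) := hℓ (by omega)
        have hE' : (if j ≤ m then exp (-β * (ℓ m - ℓ j)) else 2 - exp (-β * (ℓ j - ℓ m)))
            = 2 - exp (-β * (ℓ j - ℓ m)) := by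
          split_ifs with h
          · obtain rfl : j = m := le_antisymm h hjm
            norm_num
          · rfl
        rw [if_neg (by omega), hE', abs_sub_comm, abs_of_nonneg (sub_nonneg.2 hm1)]
        have h3 : exp (-β * (ℓ j - ℓ m)) = exp (-β * (ℓ (j + 1) - ℓ m)) * exp (β * d) := by
          rw [← exp_add, hd]; congr 1; ring
        rw [h3]
        have h4 := add_one_le_exp (β * d)
        have h5 : 1 ≤ exp (β * L) := one_le_exp (by positivity)
        have h6 : 0 ≤ β * d := by positivity
        have h7 : β * d ≤ exp (β * L) * (exp (β * d) - 1) := by nlinarith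
        have := mul_le_mul_of_nonneg_left h7 (exp_pos (-β * (ℓ (j + 1) - ℓ m))).le
        linarith
    rw [div_mul_eq_mul_div, le_div_iff₀ hβ]
    calc exp (-β * |ℓ m - ℓ (j + 1)|) * (exp d - 1) * β
        ≤ exp (-β * |ℓ m - ℓ (j + 1)|) * (d * exp L) * β := by gcongr
      _ = exp L * (exp (-β * |ℓ m - ℓ (j + 1)|) * (β * d)) := by ring
      _ ≤ exp L * (exp (β * L) * (E (j + 1) - E j)) := by gcongr
      _ = exp ((β + 1) * L) * (E (j + 1) - E j) := by
          rw [← mul_assoc, ← exp_add]; ring_nf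
  calc _ ≤ ∑ j ∈ Finset.range n, exp ((β + 1) * L) / β * (E (j + 1) - E j) :=
        Finset.sum_le_sum fun j _ => hterm j
    _ = exp ((β + 1) * L) / β * (E n - E 0) := by
        rw [← Finset.mul_sum, Finset.sum_range_sub]
    _ ≤ exp ((β + 1) * L) / β * 2 := by
        refine mul_le_mul_of_nonneg_left ?_ (by positivity)
        linarith [hE0 0, hE2 n]
    _ = _ := by ring

theorem summable_exp_mul {ℓ : ℕ → ℝ} (hℓ : Monotone ℓ) {L : ℝ}
    (hL : ∀ n, ℓ (n + 1) - ℓ n ≤ L) {β : ℝ} (hβ : 0 < β) (m : ℕ) :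
    Summable fun j => exp (-β * |ℓ m - ℓ (j + 1)|) * (exp (ℓ (j + 1) - ℓ j) - 1) :=
  summable_of_sum_range_le
    (fun j => mul_nonneg (exp_pos _).le
      (sub_nonneg.2 (one_le_exp (sub_nonneg.2 (hℓ (Nat.le_succ j))))))
    (sum_range_exp_mul_le hℓ hL hβ m)

theorem tsum_exp_mul_le {ℓ : ℕ → ℝ} (hℓ : Monotone ℓ) {L : ℝ}
    (hL : ∀ n, ℓ (n + 1) - ℓ n ≤ L) {β : ℝ} (hβ : 0 < β) (m : ℕ) :
    ∑' j, exp (-β * |ℓ m - ℓ (j + 1)|) * (exp (ℓ (j + 1) - ℓ j) - 1)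
      ≤ 2 * exp ((β + 1) * L) / β :=
  Real.tsum_le_of_sum_range_le
    (fun j => mul_nonneg (exp_pos _).le
      (sub_nonneg.2 (one_le_exp (sub_nonneg.2 (hℓ (Nat.le_succ j))))))
    (sum_range_exp_mul_le hℓ hL hβ m)

/-- A forward discrete Gronwall inequality. -/
theorem forward_gronwall {ℓ D : ℕ → ℝ} (hℓ : Monotone ℓ) {K a c : ℝ} (hK : 0 ≤ K) (ha : 0 ≤ a)
    (hKc : K * c ≤ 1) (hc : 0 ≤ c) (hD : ∀ n, 0 ≤ D n) {k : ℕ}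
    (h : ∀ m, k ≤ m → D m ≤ K * exp (a * (ℓ m - ℓ k)) * D k +
      ∑ j ∈ Finset.Ico k m,
        K * exp (a * (ℓ m - ℓ (j + 1))) * (c * (exp (ℓ (j + 1) - ℓ j) - 1) * D j))
    {m : ℕ} (hm : k ≤ m) : D m ≤ K * exp ((a + 1) * (ℓ m - ℓ k)) * D k := by
  -- This weight removes the linear growth; what remains is multiplied by at most `1 + δ j = exp (ℓ
  -- (j + 1) - ℓ j)` per step, which raises the rate from `a` to `a + 1`.
  set Y : ℕ → ℝ := fun j => exp (-(a * ℓ j)) * D j with hY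
  set δ : ℕ → ℝ := fun j => exp (ℓ (j + 1) - ℓ j) - 1 with hδ
  have hδ0 : ∀ j, 0 ≤ δ j := fun j =>
    sub_nonneg.2 (one_le_exp (sub_nonneg.2 (hℓ (Nat.le_succ j))))
  have hYm : ∀ m, k ≤ m → Y m ≤ K * Y k + ∑ j ∈ Finset.Ico k m, δ j * Y j := by
    intro m hm
    have h1 := mul_le_mul_of_nonneg_left (h m hm) (exp_pos (-(a * ℓ m))).le
    refine h1.trans ?_
    rw [mul_add, Finset.mul_sum]
    refine add_le_add (le_of_eq ?_) (Finset.sum_le_sum fun j _ => ?_)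
    · have : exp (-(a * ℓ k)) = exp (-(a * ℓ m)) * exp (a * (ℓ m - ℓ k)) := by
        rw [← exp_add]; congr 1; ring
      simp only [hY]; rw [this]; ring
    · have h2 : exp (-(a * ℓ m)) * exp (a * (ℓ m - ℓ (j + 1))) ≤ exp (-(a * ℓ j)) := by
        rw [← exp_add]; apply exp_le_exp.2
        nlinarith [hℓ (Nat.le_succ j)]
      calc exp (-(a * ℓ m)) * (K * exp (a * (ℓ m - ℓ (j + 1))) * (c * δ j * D j))
          = (exp (-(a * ℓ m)) * exp (a * (ℓ m - ℓ (j + 1)))) * ((K * c) * (δ j * D j)) := by ring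
        _ ≤ exp (-(a * ℓ j)) * (1 * (δ j * D j)) := by
            have := mul_nonneg (hδ0 j) (hD j)
            gcongr
        _ = δ j * Y j := by simp only [hY]; ring
  have hS : ∀ m, k ≤ m → K * Y k + ∑ j ∈ Finset.Ico k m, δ j * Y j
      ≤ K * Y k * exp (ℓ m - ℓ k) := by
    intro m hm
    induction m, hm using Nat.le_induction with
    | base => simp
    | succ m hm ih =>
      rw [Finset.sum_Ico_succ_top hm]
      have h1 := mul_le_mul_of_nonneg_left (hYm m hm) (hδ0 m)
      have h2 : exp (ℓ (m + 1) - ℓ k) = (1 + δ m) * exp (ℓ m - ℓ k) := by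
        simp only [hδ]; rw [add_sub_cancel, ← exp_add]; congr 1; ring
      rw [h2]
      have h3 := mul_le_mul_of_nonneg_left ih (add_nonneg zero_le_one (hδ0 m))
      linarith
  have h1 := mul_le_mul_of_nonneg_left ((hYm m hm).trans (hS m hm)) (exp_pos (a * ℓ m)).le
  have h2 : exp (a * ℓ m) * Y m = D m := by
    simp only [hY]; rw [← mul_assoc, ← exp_add]; simp
  rw [h2] at h1
  refine h1.trans (le_of_eq ?_)
  have h3 : exp ((a + 1) * (ℓ m - ℓ k)) = exp (a * ℓ m) * exp (-(a * ℓ k)) * exp (ℓ m - ℓ k) := by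
    rw [← exp_add, ← exp_add]; congr 1; ring
  rw [h3]; simp only [hY]; ring

/-- A backward discrete Gronwall inequality. -/
theorem backward_gronwall {ℓ D : ℕ → ℝ} (hℓ : Monotone ℓ) {L : ℝ}
    (hL : ∀ n, ℓ (n + 1) - ℓ n ≤ L) {K a c : ℝ} (hK : 0 ≤ K) (ha : 0 ≤ a)
    (hKc : K * c * exp ((a + 1) * L) ≤ 1) (hc : 0 ≤ c) (hD : ∀ n, 0 ≤ D n) {k : ℕ}
    (h : ∀ m, m ≤ k → D m ≤ K * exp (a * (ℓ k - ℓ m)) * D k +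
      ∑ j ∈ Finset.Ico m k,
        K * exp (a * (ℓ (j + 1) - ℓ m)) * (c * (exp (ℓ (j + 1) - ℓ j) - 1) * D j))
    {m : ℕ} (hm : m ≤ k) : D m ≤ K * exp ((a + 1) * (ℓ k - ℓ m)) * D k := by
  set Y : ℕ → ℝ := fun j => exp (a * ℓ j) * D j with hY
  set δ : ℕ → ℝ := fun j => exp (ℓ (j + 1) - ℓ j) - 1 with hδ
  -- The kernel is evaluated at `j + 1` but `D` at `j`; going backwards this costs the extra factor
  -- `exp (a * L)`.
  set q := K * c * exp (a * L) with hq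
  have hq0 : 0 ≤ q := by positivity
  have hqL : q * exp L ≤ 1 := by
    refine le_trans (le_of_eq ?_) hKc
    rw [hq, mul_assoc, ← exp_add]; congr 2; ring
  have hδ0 : ∀ j, 0 ≤ δ j := fun j =>
    sub_nonneg.2 (one_le_exp (sub_nonneg.2 (hℓ (Nat.le_succ j))))
  have hY0 : ∀ j, 0 ≤ Y j := fun j => mul_nonneg (exp_pos _).le (hD j)
  have hYm : ∀ m, m ≤ k → Y m ≤ K * Y k + ∑ j ∈ Finset.Ico m k, q * (δ j * Y j) := by
    intro m hm
    have h1 := mul_le_mul_of_nonneg_left (h m hm) (exp_pos (a * ℓ m)).le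
    refine h1.trans ?_
    rw [mul_add, Finset.mul_sum]
    refine add_le_add (le_of_eq ?_) (Finset.sum_le_sum fun j _ => ?_)
    · have : exp (a * ℓ k) = exp (a * ℓ m) * exp (a * (ℓ k - ℓ m)) := by
        rw [← exp_add]; congr 1; ring
      simp only [hY]; rw [this]; ring
    · have h2 : exp (a * ℓ m) * exp (a * (ℓ (j + 1) - ℓ m)) ≤ exp (a * L) * exp (a * ℓ j) := by
        rw [← exp_add, ← exp_add]; apply exp_le_exp.2
        nlinarith [hL j]
      calc exp (a * ℓ m) * (K * exp (a * (ℓ (j + 1) - ℓ m)) * (c * δ j * D j))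
          = (exp (a * ℓ m) * exp (a * (ℓ (j + 1) - ℓ m))) * ((K * c) * (δ j * D j)) := by ring
        _ ≤ (exp (a * L) * exp (a * ℓ j)) * ((K * c) * (δ j * D j)) := by
            have := mul_nonneg (hδ0 j) (hD j)
            gcongr
        _ = q * (δ j * Y j) := by simp only [hY, hq]; ring
  have hS : ∀ m, m ≤ k → K * Y k + ∑ j ∈ Finset.Ico m k, q * (δ j * Y j)
      ≤ K * Y k * exp (ℓ k - ℓ m) := by
    intro m hm
    induction hm using Nat.decreasingInduction with
    | self => simp
    | of_succ m hm ih =>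
      have h0 := hYm m hm.le
      set S := K * Y k + ∑ j ∈ Finset.Ico m k, q * (δ j * Y j) with hSdef
      have hsplit : S = q * (δ m * Y m) +
          (K * Y k + ∑ j ∈ Finset.Ico (m + 1) k, q * (δ j * Y j)) := by
        rw [hSdef, Finset.sum_eq_sum_Ico_succ_bot hm]; ring
      have hS0 : 0 ≤ S := (hY0 m).trans h0
      -- The sum contains its own endpoint `m`, so the inequality is implicit in `S`; the condition
      -- `q * (1 + δ m) ≤ 1` below allows that term to be absorbed.
      have h1 : S ≤ q * (δ m * S) + K * Y k * exp (ℓ k - ℓ (m + 1)) := by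
        have := mul_le_mul_of_nonneg_left (mul_le_mul_of_nonneg_left h0 (hδ0 m)) hq0
        linarith
      have h2 : exp (ℓ k - ℓ m) = (1 + δ m) * exp (ℓ k - ℓ (m + 1)) := by
        simp only [hδ]; rw [add_sub_cancel, ← exp_add]; congr 1; ring
      have h3 : 1 + δ m ≤ exp L := by
        simp only [hδ]; rw [add_sub_cancel]; exact exp_le_exp.2 (hL m)
      have h4 : q * (1 + δ m) ≤ 1 := (mul_le_mul_of_nonneg_left h3 hq0).trans hqL
      have h5 : S ≤ (1 + δ m) * (S - q * (δ m * S)) := by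
        have : 0 ≤ δ m * S * (1 - q * (1 + δ m)) :=
          mul_nonneg (mul_nonneg (hδ0 m) hS0) (by linarith)
        linarith
      rw [h2]
      have h6 := mul_le_mul_of_nonneg_left (sub_le_iff_le_add'.2 h1)
        (add_nonneg zero_le_one (hδ0 m))
      linarith
  have h1 := mul_le_mul_of_nonneg_left ((hYm m hm).trans (hS m hm)) (exp_pos (-(a * ℓ m))).le
  have h2 : exp (-(a * ℓ m)) * Y m = D m := by
    simp only [hY]; rw [← mul_assoc, ← exp_add]; simp
  rw [h2] at h1
  refine h1.trans (le_of_eq ?_)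
  have h3 : exp ((a + 1) * (ℓ k - ℓ m))
      = exp (-(a * ℓ m)) * exp (a * ℓ k) * exp (ℓ k - ℓ m) := by
    rw [← exp_add, ← exp_add]; congr 1; ring
  rw [h3]; simp only [hY]; ring

/-- Interpolation between two bounds: it trades part of a Lipschitz bound for boundedness. -/
theorem le_rpow_mul_rpow {t b₁ b₂ ρ : ℝ} (ht : 0 ≤ t) (h₁ : t ≤ b₁) (h₂ : t ≤ b₂) (hρ : 0 ≤ ρ)
    (hρ1 : ρ ≤ 1) : t ≤ b₁ ^ (1 - ρ) * b₂ ^ ρ := by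
  calc t = t ^ (1 - ρ) * t ^ ρ := by
        rw [← rpow_add_of_nonneg ht (by linarith) hρ]; simp
    _ ≤ _ := by
        have h3 := rpow_le_rpow ht h₁ (by linarith : 0 ≤ 1 - ρ)
        have h4 := rpow_le_rpow ht h₂ hρ
        have := rpow_nonneg ht ρ
        have := rpow_nonneg (ht.trans h₁) (1 - ρ)
        gcongr

end RealEstimates

/-! ### Green operators and small nonlinear perturbations in logarithmic time. -/

section Hyperbolic

open Real

variable {𝕜 X : Type*} [RCLike 𝕜] [NormedAddCommGroup X] [NormedSpace 𝕜 X]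

/-- The product `A_{n-1} ⋯ A_0`. -/
noncomputable def linearFlow (A : ℕ → X ≃L[𝕜] X) : ℕ → X ≃L[𝕜] X
  | 0 => ContinuousLinearEquiv.refl 𝕜 X
  | n + 1 => (linearFlow A n).trans (A n)

/-- The evolution family of the invertible operators `A n`. -/
noncomputable def transition (A : ℕ → X ≃L[𝕜] X) (m k : ℕ) : X ≃L[𝕜] X :=
  (linearFlow A k).symm.trans (linearFlow A m)

/-- The Green operator of the system `x_{n+1} = A_n x_n` with projections `P_n`. -/
noncomputable def greenOperator (A : ℕ → X ≃L[𝕜] X) (P : ℕ → X →L[𝕜] X) (m k : ℕ) : X →L[𝕜] X :=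
  if k ≤ m then (transition A m k : X →L[𝕜] X).comp (P k)
  else -(transition A m k : X →L[𝕜] X).comp (ContinuousLinearMap.id 𝕜 X - P k)

/-- The solution `w` of `w_{n+1} = A_n w_n + f_n` given by the Green operator. -/
noncomputable def greenSum (A : ℕ → X ≃L[𝕜] X) (P : ℕ → X →L[𝕜] X) (f : ℕ → X) (m : ℕ) : X :=
  ∑' j, greenOperator A P m (j + 1) (f j)

theorem linearFlow_succ_apply (A : ℕ → X ≃L[𝕜] X) (n : ℕ) (x : X) :
    linearFlow A (n + 1) x = A n (linearFlow A n x) := rfl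

theorem transition_apply (A : ℕ → X ≃L[𝕜] X) (m k : ℕ) (x : X) :
    transition A m k x = linearFlow A m ((linearFlow A k).symm x) := rfl

theorem transition_self (A : ℕ → X ≃L[𝕜] X) (k : ℕ) (x : X) : transition A k k x = x := by
  simp [transition_apply]

theorem transition_succ (A : ℕ → X ≃L[𝕜] X) (m k : ℕ) (x : X) :
    transition A (m + 1) k x = A m (transition A m k x) := rfl

/-- Both branches solve the linear equation; at `k = m + 1` the branch changes, and the jump is `P +
(Id - P) = Id`. -/
theorem greenOperator_succ (A : ℕ → X ≃L[𝕜] X) (P : ℕ → X →L[𝕜] X) (m k : ℕ) (x : X) :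
    greenOperator A P (m + 1) k x - A m (greenOperator A P m k x) = if k = m + 1 then x else 0 := by
  unfold greenOperator
  rcases lt_trichotomy k (m + 1) with h | rfl | h
  · rw [if_pos h.le, if_pos (Nat.lt_succ_iff.1 h), if_neg h.ne]
    simp [transition_succ]
  · rw [if_pos le_rfl, if_neg (by omega), if_pos rfl]
    have h1 : A m (transition A m (m + 1) (x - P (m + 1) x)) = x - P (m + 1) x := by
      rw [← transition_succ, transition_self]
    have h2 : transition A (m + 1) (m + 1) (P (m + 1) x) = P (m + 1) x := transition_self _ _ _
    change transition A (m + 1) (m + 1) (P (m + 1) x) -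
      A m (-(transition A m (m + 1) (x - P (m + 1) x))) = x
    rw [map_neg, h1, h2]
    abel
  · rw [if_neg (by omega), if_neg (by omega), if_neg h.ne']
    simp [transition_succ]

/-- The estimates of a dichotomy and of bounded growth, in the logarithmic time scale `ℓ`. -/
structure IsHyperbolicSystem (ℓ : ℕ → ℝ) (p : ℕ → Seminorm 𝕜 X) (A : ℕ → X ≃L[𝕜] X)
    (P : ℕ → X →L[𝕜] X) (L N ν K a : ℝ) : Prop where
  mono : Monotone ℓ
  step : ∀ n, ℓ (n + 1) - ℓ n ≤ L
  equiv : ∀ n, IsEquivalentNorm (p n)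
  N_nonneg : 0 ≤ N
  ν_pos : 0 < ν
  K_nonneg : 0 ≤ K
  a_nonneg : 0 ≤ a
  growth : ∀ m k x, p m (transition A m k x) ≤ K * exp (a * |ℓ m - ℓ k|) * p k x
  green : ∀ m k x, p m (greenOperator A P m k x) ≤ N * exp (-ν * |ℓ m - ℓ k|) * p k x

/-- The norm of `greenSum` between the spaces of bounded sequences is at most this constant. -/
noncomputable def greenConstant (L N ν : ℝ) : ℝ :=
  N * exp (ν * L) * (2 * exp ((ν / 2 + 1) * L) / (ν / 2))

namespace IsHyperbolicSystem

variable {ℓ : ℕ → ℝ} {p : ℕ → Seminorm 𝕜 X} {A : ℕ → X ≃L[𝕜] X} {P : ℕ → X →L[𝕜] X}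
  {L N ν K a : ℝ}

theorem step_nonneg (H : IsHyperbolicSystem ℓ p A P L N ν K a) (n : ℕ) : 0 ≤ ℓ (n + 1) - ℓ n :=
  sub_nonneg.2 (H.mono (Nat.le_succ n))

theorem L_nonneg (H : IsHyperbolicSystem ℓ p A P L N ν K a) : 0 ≤ L :=
  (H.step_nonneg 0).trans (H.step 0)

theorem exp_step_sub_one_nonneg (H : IsHyperbolicSystem ℓ p A P L N ν K a) (n : ℕ) :
    0 ≤ exp (ℓ (n + 1) - ℓ n) - 1 :=
  sub_nonneg.2 (one_le_exp (H.step_nonneg n))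

theorem greenConstant_nonneg (H : IsHyperbolicSystem ℓ p A P L N ν K a) :
    0 ≤ greenConstant L N ν := by
  have := H.N_nonneg
  have := H.ν_pos
  unfold greenConstant
  positivity

/-- By the triangle inequality the weight at time `j` is transferred to time `m` at the cost of at
most half the decay rate `ν`; the other half makes the terms summable in `j`. -/
theorem greenOperator_le (H : IsHyperbolicSystem ℓ p A P L N ν K a) {γ B : ℝ}
    (hγ : 0 ≤ γ) (hγν : γ ≤ ν / 2) {f : ℕ → X} {n : ℕ} (hB : 0 ≤ B)
    (hf : ∀ j, p (j + 1) (f j) ≤ (exp (ℓ (j + 1) - ℓ j) - 1) * (B * exp (γ * |ℓ j - ℓ n|)))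
    (m j : ℕ) :
    p m (greenOperator A P m (j + 1) (f j)) ≤ N * exp (ν * L) * (B * exp (γ * |ℓ m - ℓ n|)) *
      (exp (-(ν / 2) * |ℓ m - ℓ (j + 1)|) * (exp (ℓ (j + 1) - ℓ j) - 1)) := by
  have hN := H.N_nonneg
  have hδ := H.exp_step_sub_one_nonneg j
  have hν := H.ν_pos
  have hL := H.L_nonneg
  have h1 : exp (-ν * |ℓ m - ℓ (j + 1)|) * exp (γ * |ℓ j - ℓ n|) ≤
      exp (ν * L) * exp (γ * |ℓ m - ℓ n|) * exp (-(ν / 2) * |ℓ m - ℓ (j + 1)|) := by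
    rw [← exp_add, ← exp_add, ← exp_add]
    apply exp_le_exp.2
    have h2 : |ℓ j - ℓ n| ≤ L + |ℓ m - ℓ (j + 1)| + |ℓ m - ℓ n| := by
      have e : ℓ j - ℓ n = -(ℓ (j + 1) - ℓ j) + -(ℓ m - ℓ (j + 1)) + (ℓ m - ℓ n) := by ring
      rw [e]
      refine (abs_add_three _ _ _).trans ?_
      rw [abs_neg, abs_neg, abs_of_nonneg (H.step_nonneg j)]
      gcongr
      exact H.step j
    have h3 := mul_le_mul_of_nonneg_left h2 hγ
    have h4 := mul_le_mul_of_nonneg_right hγν (abs_nonneg (ℓ m - ℓ (j + 1)))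
    have h5 := mul_le_mul_of_nonneg_right (hγν.trans (by linarith : ν / 2 ≤ ν)) hL
    linarith
  calc p m (greenOperator A P m (j + 1) (f j))
      ≤ N * exp (-ν * |ℓ m - ℓ (j + 1)|) * p (j + 1) (f j) := H.green m (j + 1) (f j)
    _ ≤ N * exp (-ν * |ℓ m - ℓ (j + 1)|) *
          ((exp (ℓ (j + 1) - ℓ j) - 1) * (B * exp (γ * |ℓ j - ℓ n|))) := by
        gcongr; exact hf j
    _ = N * B * (exp (ℓ (j + 1) - ℓ j) - 1) *
          (exp (-ν * |ℓ m - ℓ (j + 1)|) * exp (γ * |ℓ j - ℓ n|)) := by ring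
    _ ≤ N * B * (exp (ℓ (j + 1) - ℓ j) - 1) *
          (exp (ν * L) * exp (γ * |ℓ m - ℓ n|) * exp (-(ν / 2) * |ℓ m - ℓ (j + 1)|)) := by
        gcongr
    _ = _ := by ring

/-- Variation of constants between two times. -/
theorem transition_sub_transition {d f : ℕ → X} (hd : ∀ j, d (j + 1) = A j (d j) + f j)
    {k m : ℕ} (hkm : k ≤ m) (i : ℕ) :
    transition A i m (d m) - transition A i k (d k)
      = ∑ j ∈ Finset.Ico k m, transition A i (j + 1) (f j) := by
  have h : ∀ j, transition A i (j + 1) (f j)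
      = transition A i (j + 1) (d (j + 1)) - transition A i j (d j) := by
    intro j
    rw [hd, map_add]
    have : transition A i (j + 1) (A j (d j)) = transition A i j (d j) := by
      rw [transition_apply, transition_apply]
      congr 1
      rw [ContinuousLinearEquiv.symm_apply_eq, linearFlow_succ_apply]
      simp
    rw [this]
    abel
  simp_rw [h]
  rw [Finset.sum_Ico_sub (fun j => transition A i j (d j)) hkm]

/-- Variation of constants feeds the two Gronwall inequalities. It is applied to the difference of
two nonlinear orbits. -/
theorem le_of_perturbation_le (H : IsHyperbolicSystem ℓ p A P L N ν K a) {c : ℝ} (hc : 0 ≤ c)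
    (hKc : K * c * exp ((a + 1) * L) ≤ 1) {d f : ℕ → X} (hd : ∀ j, d (j + 1) = A j (d j) + f j)
    (hf : ∀ j, p (j + 1) (f j) ≤ c * (exp (ℓ (j + 1) - ℓ j) - 1) * p j (d j)) (m k : ℕ) :
    p m (d m) ≤ K * exp ((a + 1) * |ℓ m - ℓ k|) * p k (d k) := by
  have hK := H.K_nonneg
  have ha := H.a_nonneg
  have hL := H.L_nonneg
  rcases le_total k m with h | h
  · rw [abs_of_nonneg (sub_nonneg.2 (H.mono h))]
    have hKc' : K * c ≤ 1 := by
      refine le_trans ?_ hKc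
      exact le_mul_of_one_le_right (by positivity) (one_le_exp (by positivity))
    refine forward_gronwall (D := fun j => p j (d j)) H.mono hK ha hKc' hc
      (fun _ => apply_nonneg _ _) (fun m hm => ?_) h
    have h1 := transition_sub_transition (A := A) hd hm m
    rw [transition_self, sub_eq_iff_eq_add'] at h1
    conv_lhs => rw [h1]
    refine (map_add_le_add (p m) _ _).trans (add_le_add ?_ ?_)
    · simpa [abs_of_nonneg (sub_nonneg.2 (H.mono hm))] using H.growth m k (d k)
    · refine ((p m).sum_le _ _).trans (Finset.sum_le_sum fun j hj => ?_)
      refine (H.growth m (j + 1) (f j)).trans ?_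
      rw [abs_of_nonneg (sub_nonneg.2 (H.mono (Finset.mem_Ico.1 hj).2))]
      gcongr
      exact hf j
  · rw [abs_sub_comm, abs_of_nonneg (sub_nonneg.2 (H.mono h))]
    refine backward_gronwall (D := fun j => p j (d j)) H.mono H.step hK ha hKc hc
      (fun _ => apply_nonneg _ _) (fun m hm => ?_) h
    have h1 := transition_sub_transition (A := A) hd hm m
    rw [transition_self, sub_eq_iff_eq_add', ← sub_eq_iff_eq_add] at h1
    conv_lhs => rw [← h1]
    refine (map_sub_le_add (p m) _ _).trans (add_le_add ?_ ?_)
    · simpa [abs_sub_comm (ℓ m), abs_of_nonneg (sub_nonneg.2 (H.mono hm))] using H.growth m k (d k)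
    · refine ((p m).sum_le _ _).trans (Finset.sum_le_sum fun j hj => ?_)
      refine (H.growth m (j + 1) (f j)).trans ?_
      have hj' : m ≤ j + 1 := (Finset.mem_Ico.1 hj).1.trans (Nat.le_succ j)
      rw [abs_sub_comm, abs_of_nonneg (sub_nonneg.2 (H.mono hj'))]
      gcongr
      exact hf j

variable [CompleteSpace X]

theorem greenSum_summable (H : IsHyperbolicSystem ℓ p A P L N ν K a) {B : ℝ} {f : ℕ → X}
    (hB : 0 ≤ B) (hf : ∀ j, p (j + 1) (f j) ≤ (exp (ℓ (j + 1) - ℓ j) - 1) * B) (m : ℕ) :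
    Summable fun j => greenOperator A P m (j + 1) (f j) :=
  (H.equiv m).summable
    ((summable_exp_mul H.mono H.step (half_pos H.ν_pos) m).mul_left _)
    (H.greenOperator_le (γ := 0) (n := m) le_rfl (half_pos H.ν_pos).le hB (by simpa using hf) m)

theorem greenSum_le (H : IsHyperbolicSystem ℓ p A P L N ν K a) {γ B : ℝ}
    (hγ : 0 ≤ γ) (hγν : γ ≤ ν / 2) {f : ℕ → X} {n : ℕ} (hB : 0 ≤ B)
    (hf : ∀ j, p (j + 1) (f j) ≤ (exp (ℓ (j + 1) - ℓ j) - 1) * (B * exp (γ * |ℓ j - ℓ n|)))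
    (m : ℕ) : p m (greenSum A P f m) ≤ greenConstant L N ν * B * exp (γ * |ℓ m - ℓ n|) := by
  have hν := half_pos H.ν_pos
  have hN := H.N_nonneg
  refine ((H.equiv m).tsum_le ((summable_exp_mul H.mono H.step hν m).mul_left _)
    (H.greenOperator_le hγ hγν hB hf m)).trans ?_
  rw [tsum_mul_left]
  refine (mul_le_mul_of_nonneg_left (tsum_exp_mul_le H.mono H.step hν m)
    (by positivity)).trans (le_of_eq ?_)
  unfold greenConstant
  ring

theorem greenSum_le_of_bounded (H : IsHyperbolicSystem ℓ p A P L N ν K a) {B : ℝ} {f : ℕ → X}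
    (hB : 0 ≤ B) (hf : ∀ j, p (j + 1) (f j) ≤ (exp (ℓ (j + 1) - ℓ j) - 1) * B) (m : ℕ) :
    p m (greenSum A P f m) ≤ greenConstant L N ν * B := by
  simpa using H.greenSum_le (γ := 0) (n := m) le_rfl (half_pos H.ν_pos).le hB
    (by simpa using hf) m

theorem greenSum_sub (H : IsHyperbolicSystem ℓ p A P L N ν K a) {B : ℝ} {f f' : ℕ → X}
    (hB : 0 ≤ B) (hf : ∀ j, p (j + 1) (f j) ≤ (exp (ℓ (j + 1) - ℓ j) - 1) * B)
    (hf' : ∀ j, p (j + 1) (f' j) ≤ (exp (ℓ (j + 1) - ℓ j) - 1) * B) (m : ℕ) :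
    greenSum A P f m - greenSum A P f' m = greenSum A P (fun j => f j - f' j) m := by
  unfold greenSum
  rw [← (H.greenSum_summable hB hf m).tsum_sub (H.greenSum_summable hB hf' m)]
  simp

theorem greenSum_succ (H : IsHyperbolicSystem ℓ p A P L N ν K a) {B : ℝ} {f : ℕ → X}
    (hB : 0 ≤ B) (hf : ∀ j, p (j + 1) (f j) ≤ (exp (ℓ (j + 1) - ℓ j) - 1) * B) (m : ℕ) :
    greenSum A P f (m + 1) = A m (greenSum A P f m) + f m := by
  have h1 := H.greenSum_summable hB hf m
  have h2 := H.greenSum_summable hB hf (m + 1)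
  rw [← sub_eq_iff_eq_add']
  unfold greenSum
  rw [(A m).map_tsum, ← h2.tsum_sub ((A m).summable.2 h1)]
  simp_rw [greenOperator_succ]
  simp

end IsHyperbolicSystem

/-- The nonlinear terms `g_n` are uniformly bounded and Lipschitz, relative to the time scale. -/
structure IsSmallPerturbation (ℓ : ℕ → ℝ) (p : ℕ → Seminorm 𝕜 X) (g : ℕ → X → X) (M c : ℝ) :
    Prop where
  M_nonneg : 0 ≤ M
  c_nonneg : 0 ≤ c
  bound : ∀ n x, p (n + 1) (g n x) ≤ (exp (ℓ (n + 1) - ℓ n) - 1) * M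
  lipschitz : ∀ n x y,
    p (n + 1) (g n x - g n y) ≤ c * (exp (ℓ (n + 1) - ℓ n) - 1) * p n (x - y)

namespace IsSmallPerturbation

variable {ℓ : ℕ → ℝ} {p : ℕ → Seminorm 𝕜 X} {A : ℕ → X ≃L[𝕜] X} {P : ℕ → X →L[𝕜] X}
  {L N ν K a M c : ℝ} {g : ℕ → X → X}

/-- Interpolation leaves the time weight at the first power while the growth rate `a + 1` shrinks to
`ρ * (a + 1)`, which the Green operator can tolerate. -/
theorem sub_le_rpow (G : IsSmallPerturbation ℓ p g M c)
    (H : IsHyperbolicSystem ℓ p A P L N ν K a) {ρ : ℝ} (hρ : 0 ≤ ρ) (hρ1 : ρ ≤ 1)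
    {n k : ℕ} {x y : X} {s : ℝ} (hs : 0 ≤ s)
    (hxy : p n (x - y) ≤ K * exp ((a + 1) * |ℓ n - ℓ k|) * s) :
    p (n + 1) (g n x - g n y) ≤ (exp (ℓ (n + 1) - ℓ n) - 1) *
      ((2 * M) ^ (1 - ρ) * (c * K) ^ ρ * s ^ ρ * exp (ρ * (a + 1) * |ℓ n - ℓ k|)) := by
  have hδ := H.exp_step_sub_one_nonneg n
  have hM := G.M_nonneg
  have hc := G.c_nonneg
  have hK := H.K_nonneg
  set δ := exp (ℓ (n + 1) - ℓ n) - 1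
  have h1 : p (n + 1) (g n x - g n y) ≤ δ * (2 * M) :=
    (map_sub_le_add _ _ _).trans
      ((add_le_add (G.bound n x) (G.bound n y)).trans (le_of_eq (by ring)))
  have h2 : p (n + 1) (g n x - g n y) ≤ δ * (c * K * s * exp ((a + 1) * |ℓ n - ℓ k|)) :=
    (G.lipschitz n x y).trans ((mul_le_mul_of_nonneg_left hxy (by positivity)).trans
      (le_of_eq (by ring)))
  refine (le_rpow_mul_rpow (apply_nonneg _ _) h1 h2 hρ hρ1).trans (le_of_eq ?_)
  rw [mul_rpow hδ (by positivity), mul_rpow hδ (by positivity),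
    mul_rpow (by positivity) (exp_pos _).le, mul_rpow (by positivity) hs, ← exp_mul]
  have h3 : δ ^ (1 - ρ) * δ ^ ρ = δ := by
    rw [← rpow_add_of_nonneg hδ (by linarith) hρ]; simp
  have h4 : (a + 1) * |ℓ n - ℓ k| * ρ = ρ * (a + 1) * |ℓ n - ℓ k| := by ring
  rw [h4]
  calc _ = (δ ^ (1 - ρ) * δ ^ ρ) * ((2 * M) ^ (1 - ρ) * (c * K) ^ ρ * s ^ ρ *
        exp (ρ * (a + 1) * |ℓ n - ℓ k|)) := by ring
    _ = _ := by rw [h3]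

variable [CompleteSpace X]

theorem greenSum_le (G : IsSmallPerturbation ℓ p g M c)
    (H : IsHyperbolicSystem ℓ p A P L N ν K a) (x : ℕ → X) (m : ℕ) :
    p m (greenSum A P (fun j => g j (x j)) m) ≤ greenConstant L N ν * M :=
  H.greenSum_le_of_bounded G.M_nonneg (fun j => G.bound j (x j)) m

theorem greenSum_sub (G : IsSmallPerturbation ℓ p g M c)
    (H : IsHyperbolicSystem ℓ p A P L N ν K a) (x x' : ℕ → X) (m : ℕ) :
    greenSum A P (fun j => g j (x j)) m - greenSum A P (fun j => g j (x' j)) m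
      = greenSum A P (fun j => g j (x j) - g j (x' j)) m :=
  H.greenSum_sub G.M_nonneg (fun j => G.bound j (x j)) (fun j => G.bound j (x' j)) m

theorem greenSum_succ (G : IsSmallPerturbation ℓ p g M c)
    (H : IsHyperbolicSystem ℓ p A P L N ν K a) (x : ℕ → X) (m : ℕ) :
    greenSum A P (fun j => g j (x j)) (m + 1)
      = A m (greenSum A P (fun j => g j (x j)) m) + g m (x m) :=
  H.greenSum_succ G.M_nonneg (fun j => G.bound j (x j)) m

theorem greenSum_sub_le_rpow (G : IsSmallPerturbation ℓ p g M c)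
    (H : IsHyperbolicSystem ℓ p A P L N ν K a) {ρ : ℝ} (hρ : 0 ≤ ρ) (hρ1 : ρ ≤ 1)
    (hρν : ρ * (a + 1) ≤ ν / 2) {k : ℕ} {x x' : ℕ → X} {s : ℝ} (hs : 0 ≤ s)
    (hx : ∀ j, p j (x j - x' j) ≤ K * exp ((a + 1) * |ℓ j - ℓ k|) * s) (m : ℕ) :
    p m (greenSum A P (fun j => g j (x j)) m - greenSum A P (fun j => g j (x' j)) m)
      ≤ greenConstant L N ν * ((2 * M) ^ (1 - ρ) * (c * K) ^ ρ * s ^ ρ) *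
        exp (ρ * (a + 1) * |ℓ m - ℓ k|) := by
  have hM := G.M_nonneg
  have hc := G.c_nonneg
  have hK := H.K_nonneg
  have ha := H.a_nonneg
  rw [G.greenSum_sub H]
  exact H.greenSum_le (by positivity) hρν (by positivity)
    (fun j => G.sub_le_rpow H hρ hρ1 hs (hx j)) m

/-- Hölder dependence of the bounded solutions of `w = greenSum (g (y + w))` on `y`. -/
theorem fixedPoint_sub_le_rpow (G : IsSmallPerturbation ℓ p g M c)
    (H : IsHyperbolicSystem ℓ p A P L N ν K a) (hcG : greenConstant L N ν * c ≤ 1 / 2)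
    {ρ : ℝ} (hρ : 0 ≤ ρ) (hρ1 : ρ ≤ 1)
    (hρν : ρ * (a + 1) ≤ ν / 2) {k : ℕ} {y y' w w' : ℕ → X} {s : ℝ} (hs : 0 ≤ s)
    (hy : ∀ j, p j (y j - y' j) ≤ K * exp ((a + 1) * |ℓ j - ℓ k|) * s)
    (hw : greenSum A P (fun j => g j (y j + w j)) = w)
    (hw' : greenSum A P (fun j => g j (y' j + w' j)) = w') (m : ℕ) :
    p m (w m - w' m) ≤ 2 * (greenConstant L N ν * ((2 * M) ^ (1 - ρ) * (c * K) ^ ρ * s ^ ρ)) *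
        exp (ρ * (a + 1) * |ℓ m - ℓ k|) := by
  have hM := G.M_nonneg
  have hc := G.c_nonneg
  have hK := H.K_nonneg
  have ha := H.a_nonneg
  have hκ := H.greenConstant_nonneg
  set κ := greenConstant L N ν
  set R := κ * ((2 * M) ^ (1 - ρ) * (c * K) ^ ρ * s ^ ρ) with hR
  set γ := ρ * (a + 1) with hγ
  have hγ0 : 0 ≤ γ := by positivity
  have hR0 : 0 ≤ R := by positivity
  -- A bound with constant `B` improves to `R + B / 2`: `R` comes from varying `y`, and `B / 2` from
  -- varying `w`. Iterating from the a priori bound `2 * (κ * M)` converges to `2 * R`.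
  have hstep : ∀ B, 0 ≤ B → (∀ m, p m (w m - w' m) ≤ B * exp (γ * |ℓ m - ℓ k|)) →
      ∀ m, p m (w m - w' m) ≤ (R + B / 2) * exp (γ * |ℓ m - ℓ k|) := by
    intro B hB hwB m
    have e : w m - w' m = (greenSum A P (fun j => g j (y j + w j)) m -
        greenSum A P (fun j => g j (y' j + w j)) m) +
        (greenSum A P (fun j => g j (y' j + w j)) m -
        greenSum A P (fun j => g j (y' j + w' j)) m) := by
      rw [hw, hw']; abel
    have h1 := G.greenSum_sub_le_rpow H hρ hρ1 hρν (x := fun j => y j + w j)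
      (x' := fun j => y' j + w j) hs (fun j => by simpa using hy j) m
    have h2 : p m (greenSum A P (fun j => g j (y' j + w j)) m -
        greenSum A P (fun j => g j (y' j + w' j)) m)
        ≤ κ * (c * B) * exp (γ * |ℓ m - ℓ k|) := by
      rw [G.greenSum_sub H (fun j => y' j + w j) (fun j => y' j + w' j)]
      refine H.greenSum_le hγ0 hρν (by positivity) (fun j => ?_) m
      refine (G.lipschitz j _ _).trans ?_
      rw [add_sub_add_left_eq_sub]
      have hδ := H.exp_step_sub_one_nonneg j
      refine (mul_le_mul_of_nonneg_left (hwB j) (by positivity)).trans (le_of_eq (by ring))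
    rw [e]
    refine (map_add_le_add (p m) _ _).trans ((add_le_add h1 h2).trans ?_)
    rw [← add_mul]
    have h3 := mul_le_mul_of_nonneg_right hcG hB
    refine mul_le_mul_of_nonneg_right ?_ (exp_pos _).le
    linarith
  have hiter : ∀ i : ℕ, ∀ m, p m (w m - w' m) ≤
      (2 * R + 2 * (κ * M) * (1 / 2) ^ i) * exp (γ * |ℓ m - ℓ k|) := by
    intro i
    induction i with
    | zero =>
      intro m
      have h1 := G.greenSum_le H (fun j => y j + w j) m
      have h2 := G.greenSum_le H (fun j => y' j + w' j) m
      rw [hw] at h1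
      rw [hw'] at h2
      refine (map_sub_le_add (p m) _ _).trans ((add_le_add h1 h2).trans ?_)
      have h3 : 1 ≤ exp (γ * |ℓ m - ℓ k|) := one_le_exp (by positivity)
      have h4 : 0 ≤ κ * M := by positivity
      nlinarith
    | succ i ih =>
      intro m
      refine (hstep _ (by positivity) ih m).trans (le_of_eq ?_)
      ring
  have hlim : Tendsto (fun i : ℕ => (2 * R + 2 * (κ * M) * (1 / 2) ^ i) *
      exp (γ * |ℓ m - ℓ k|)) atTop (nhds (2 * R * exp (γ * |ℓ m - ℓ k|))) := by
    have h := tendsto_pow_atTop_nhds_zero_of_lt_one (r := (1 / 2 : ℝ)) (by norm_num) (by norm_num)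
    simpa using ((h.const_mul (2 * (κ * M))).const_add (2 * R)).mul_const
      (exp (γ * |ℓ m - ℓ k|))
  exact ge_of_tendsto' hlim fun i => hiter i m

/-- This is the Hölder estimate with both data equal to `y`, so that `s = 0`. -/
theorem fixedPoint_unique (G : IsSmallPerturbation ℓ p g M c)
    (H : IsHyperbolicSystem ℓ p A P L N ν K a) (hcG : greenConstant L N ν * c ≤ 1 / 2)
    {y w w' : ℕ → X} (hw : greenSum A P (fun j => g j (y j + w j)) = w)
    (hw' : greenSum A P (fun j => g j (y j + w' j)) = w') : w = w' := by
  have ha := H.a_nonneg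
  have hν := H.ν_pos
  set ρ := min 1 (ν / 2 / (a + 1)) with hρ
  have hρ0 : 0 < ρ := lt_min one_pos (by positivity)
  have hρν : ρ * (a + 1) ≤ ν / 2 := by
    rw [← le_div_iff₀ (by positivity)]; exact min_le_right _ _
  funext m
  have h := G.fixedPoint_sub_le_rpow H hcG hρ0.le (min_le_left _ _) hρν (k := 0) (y := y) (y' := y)
    (s := 0) le_rfl (fun j => by simp) hw hw' m
  rw [zero_rpow hρ0.ne'] at h
  simp only [mul_zero, zero_mul] at h
  exact sub_eq_zero.1 ((H.equiv m).eq_zero h)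

theorem exists_fixedPoint (G : IsSmallPerturbation ℓ p g M c)
    (H : IsHyperbolicSystem ℓ p A P L N ν K a) (hcG : greenConstant L N ν * c ≤ 1 / 2)
    (y : ℕ → X) : ∃ w : ℕ → X, greenSum A P (fun j => g j (y j + w j)) = w := by
  have hc := G.c_nonneg
  have hM := G.M_nonneg
  have hκ := H.greenConstant_nonneg
  refine exists_fixedPoint_of_contraction H.equiv
    (T := fun w => greenSum A P (fun j => g j (y j + w j))) (q := 1 / 2)
    (B := greenConstant L N ν * M) (by norm_num) (by norm_num) ?_ (by positivity)
    (fun i => G.greenSum_le H _ i)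
  intro w w' C hC hww m
  rw [G.greenSum_sub H (fun j => y j + w j) (fun j => y j + w' j)]
  refine (H.greenSum_le_of_bounded (B := c * C) (by positivity) (fun j => ?_) m).trans ?_
  · refine (G.lipschitz j _ _).trans ?_
    rw [add_sub_add_left_eq_sub]
    have hδ := H.exp_step_sub_one_nonneg j
    refine (mul_le_mul_of_nonneg_left (hww j) (by positivity)).trans (le_of_eq (by ring))
  · rw [← mul_assoc]
    exact mul_le_mul_of_nonneg_right hcG hC

/-- Needed so that every point at time `n` lies on a unique full orbit, extended back to time 0. -/
theorem bijective (G : IsSmallPerturbation ℓ p g M c)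
    (H : IsHyperbolicSystem ℓ p A P L N ν K a) (hKc : K * c * exp ((a + 1) * L) ≤ 1) (n : ℕ) :
    Function.Bijective fun x => A n x + g n x := by
  have hK := H.K_nonneg
  have hc := G.c_nonneg
  have ha := H.a_nonneg
  have hδ := H.exp_step_sub_one_nonneg n
  refine bijective_add_of_contraction (q := p (n + 1)) (H.equiv n) (A n) (κ := K * exp (a * L))
    (ε := c * (exp (ℓ (n + 1) - ℓ n) - 1)) (by positivity) (by positivity) ?_ ?_ (G.lipschitz n)
  · have h1 : exp (ℓ (n + 1) - ℓ n) ≤ exp L := exp_le_exp.2 (H.step n)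
    have h2 : exp ((a + 1) * L) = exp (a * L) * exp L := by rw [← exp_add]; congr 1; ring
    rw [h2] at hKc
    have h3 : 0 ≤ K * c * exp (a * L) := by positivity
    -- Strictness comes from `exp (ℓ (n + 1) - ℓ n) - 1 < exp L`, which helps only when the factor
    -- is nonzero.
    rcases h3.eq_or_lt with h4 | h4
    · have : K * exp (a * L) * (c * (exp (ℓ (n + 1) - ℓ n) - 1))
          = K * c * exp (a * L) * (exp (ℓ (n + 1) - ℓ n) - 1) := by ring
      rw [this, ← h4]; norm_num
    · nlinarith
  · intro x
    have h1 := H.growth n (n + 1) x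
    have h2 : transition A n (n + 1) x = (A n).symm x := by
      rw [ContinuousLinearEquiv.eq_symm_apply, ← transition_succ, transition_self]
    rw [h2, abs_sub_comm, abs_of_nonneg (H.step_nonneg n)] at h1
    refine h1.trans ?_
    gcongr
    exact H.step n

end IsSmallPerturbation

end Hyperbolic

/-! ### Construction of the conjugacy and its inverse. -/

section Conjugacy

open Real

variable {𝕜 X : Type*} [RCLike 𝕜] [NormedAddCommGroup X] [NormedSpace 𝕜 X]

/-- The composition `F_{n-1} ∘ ⋯ ∘ F_0`. -/
def nonlinearFlow {Y : Type*} (F : ℕ → Y ≃ Y) : ℕ → Y ≃ Y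
  | 0 => Equiv.refl Y
  | n + 1 => (nonlinearFlow F n).trans (F n)

theorem nonlinearFlow_succ_apply {Y : Type*} (F : ℕ → Y ≃ Y) (n : ℕ) (x : Y) :
    nonlinearFlow F (n + 1) x = F n (nonlinearFlow F n x) := rfl

theorem eq_nonlinearFlow {Y : Type*} {F : ℕ → Y ≃ Y} {x : ℕ → Y}
    (hx : ∀ n, x (n + 1) = F n (x n)) (n j : ℕ) :
    nonlinearFlow F j ((nonlinearFlow F n).symm (x n)) = x j := by
  have h : ∀ i, x i = nonlinearFlow F i (x 0) := by
    intro i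
    induction i with
    | zero => rfl
    | succ i ih => rw [hx, nonlinearFlow_succ_apply, ← ih]
  rw [h n, Equiv.symm_apply_apply, ← h j]

theorem transition_eq {A : ℕ → X ≃L[𝕜] X} {y : ℕ → X} (hy : ∀ n, y (n + 1) = A n (y n)) (n j : ℕ) :
    transition A j n (y n) = y j := by
  have h : ∀ i, y i = linearFlow A i (y 0) := by
    intro i
    induction i with
    | zero => rfl
    | succ i ih => rw [hy, linearFlow_succ_apply, ← ih]
  rw [transition_apply, h n, ContinuousLinearEquiv.symm_apply_apply, ← h j]

/-- A map that is Hölder continuous for an equivalent norm is continuous. -/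
theorem IsEquivalentNorm.continuous_of_holder {p : Seminorm 𝕜 X} (hp : IsEquivalentNorm p)
    {f : X → X} {C ρ : ℝ} (hρ : 0 < ρ) (hf : ∀ x y, p (f x - f y) ≤ C * p (x - y) ^ ρ) :
    Continuous f := by
  obtain ⟨b, B, hb, hB, h⟩ := id hp
  rw [continuous_iff_continuousAt]
  intro y
  rw [ContinuousAt, tendsto_iff_norm_sub_tendsto_zero]
  have h1 : Tendsto (fun x => b⁻¹ * (C * p (x - y) ^ ρ)) (nhds y) (nhds 0) := by
    have h2 : Continuous fun x => b⁻¹ * (C * p (x - y) ^ ρ) := by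
      have h3 : Continuous fun x => p (x - y) :=
        hp.continuous.comp (continuous_id.sub continuous_const)
      exact (((h3.rpow_const fun _ => Or.inr hρ.le)).const_mul C).const_mul _
    simpa [zero_rpow hρ.ne'] using h2.tendsto y
  refine squeeze_zero (fun _ => norm_nonneg _) (fun x => ?_) h1
  rw [inv_mul_eq_div, le_div_iff₀ hb, mul_comm]
  exact (h _).1.trans (hf x y)

/-- For `s ≤ 1` the Lipschitz part is absorbed because `s ≤ s ^ ρ`; only the identity part of the
conjugacy forces a restriction to small distances. -/
theorem le_add_mul_rpow {s t R E ρ : ℝ} (hρ1 : ρ ≤ 1) (hs : 0 ≤ s) (hs1 : s ≤ 1)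
    (ht : t ≤ E * s + R * s ^ ρ) (hE : 0 ≤ E) : t ≤ (E + R) * s ^ ρ := by
  rcases hs.eq_or_lt with rfl | hs0
  · have := mul_nonneg hE (rpow_nonneg le_rfl ρ)
    linarith
  · have := rpow_le_rpow_of_exponent_ge hs0 hs1 hρ1
    rw [rpow_one] at this
    nlinarith

variable [CompleteSpace X]

/-- The conjugacy theorem for hyperbolic systems of invertible operators indexed by `ℕ`. -/
theorem IsSmallPerturbation.exists_conjugacy {ℓ : ℕ → ℝ} {p : ℕ → Seminorm 𝕜 X}
    {A : ℕ → X ≃L[𝕜] X} {P : ℕ → X →L[𝕜] X} {L N ν K a M c : ℝ} {g : ℕ → X → X}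
    (G : IsSmallPerturbation ℓ p g M c) (H : IsHyperbolicSystem ℓ p A P L N ν K a)
    (hcG : greenConstant L N ν * c ≤ 1 / 2) (hKc : K * c * exp ((a + 1) * L) ≤ 1) :
    ∃ h : ℕ → X ≃ₜ X,
      (∀ n x, h (n + 1) (A n x + g n x) = A n (h n x)) ∧
      (∃ D : ℝ, 0 < D ∧ ∀ n x, p n (h n x - x) ≤ D ∧ p n ((h n).symm x - x) ≤ D) ∧
      (∃ C ρ δ : ℝ, 0 < C ∧ 0 < ρ ∧ 0 < δ ∧ ∀ n x y, p n (x - y) ≤ δ →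
        p n (h n x - h n y) ≤ C * p n (x - y) ^ ρ ∧
        p n ((h n).symm x - (h n).symm y) ≤ C * p n (x - y) ^ ρ) := by
  have hM := G.M_nonneg
  have hc := G.c_nonneg
  have hK := H.K_nonneg
  have ha := H.a_nonneg
  have hν := H.ν_pos
  have hκ := H.greenConstant_nonneg
  set ρ := min 1 (ν / 2 / (a + 1)) with hρ
  have hρ0 : 0 < ρ := lt_min one_pos (by positivity)
  have hρ1 : ρ ≤ 1 := min_le_left _ _
  have hρν : ρ * (a + 1) ≤ ν / 2 := by
    rw [← le_div_iff₀ (by positivity)]; exact min_le_right _ _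
  let F : ℕ → X ≃ X := fun n => Equiv.ofBijective _ (G.bijective H hKc n)
  have hF : ∀ n x, F n x = A n x + g n x := fun _ _ => rfl
  let orbit : ℕ → X → ℕ → X := fun n x j =>
    nonlinearFlow F j ((nonlinearFlow F n).symm x)
  have horbit_self : ∀ n x, orbit n x n = x := fun n x => Equiv.apply_symm_apply _ _
  have horbit_succ : ∀ n x j, orbit n x (j + 1) = A j (orbit n x j) + g j (orbit n x j) :=
    fun _ _ _ => rfl
  choose W hW using G.exists_fixedPoint H hcG
  -- `u` is the correction along the nonlinear orbit through `x` at time `n`, and `v` the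
  -- fixed-point correction along the linear orbit through `y`. The maps sought are `x - u n x n`
  -- and `y + v n y n`.
  let u : ℕ → X → ℕ → X := fun n x => greenSum A P (fun j => g j (orbit n x j))
  let v : ℕ → X → ℕ → X := fun n y => W (fun j => transition A j n y)
  have hv : ∀ n y, greenSum A P (fun j => g j (transition A j n y + v n y j)) = v n y :=
    fun n y => hW _
  have hu_le : ∀ n x, p n (u n x n) ≤ greenConstant L N ν * M := fun n x => G.greenSum_le H _ n
  have hv_le : ∀ n y, p n (v n y n) ≤ greenConstant L N ν * M := fun n y => by
    rw [← hv]; exact G.greenSum_le H _ n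
  set R := 2 * (greenConstant L N ν * ((2 * M) ^ (1 - ρ) * (c * K) ^ ρ)) with hR
  have hR0 : 0 ≤ R := by positivity
  have hu_holder : ∀ n x y, p n (u n x n - u n y n) ≤ R * p n (x - y) ^ ρ := by
    intro n x y
    -- Orbits are compared with base time `n` and evaluated at that same time, where the exponential
    -- weight is 1.
    have h1 := G.greenSum_sub_le_rpow H hρ0.le hρ1 hρν (k := n) (x := orbit n x)
      (x' := orbit n y) (s := p n (x - y)) (apply_nonneg _ _) (fun j => ?_) n
    · refine h1.trans ?_
      rw [sub_self, abs_zero, mul_zero, exp_zero, mul_one]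
      have : 0 ≤ greenConstant L N ν * ((2 * M) ^ (1 - ρ) * (c * K) ^ ρ) * p n (x - y) ^ ρ := by
        positivity
      rw [hR]
      linarith
    · have h2 := H.le_of_perturbation_le hc hKc (d := fun j => orbit n x j - orbit n y j)
        (f := fun j => g j (orbit n x j) - g j (orbit n y j))
        (fun j => by rw [horbit_succ, horbit_succ, map_sub]; abel)
        (fun j => G.lipschitz j _ _) j n
      simpa only [horbit_self] using h2
  have hv_holder : ∀ n x y, p n (v n x n - v n y n) ≤ R * p n (x - y) ^ ρ := by
    intro n x y
    have h1 := G.fixedPoint_sub_le_rpow H hcG hρ0.le hρ1 hρν (k := n) (s := p n (x - y))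
      (apply_nonneg _ _) (fun j => ?_) (hv n x) (hv n y) n
    · refine h1.trans (le_of_eq ?_)
      rw [sub_self, abs_zero, mul_zero, exp_zero, mul_one, hR]
      ring
    · rw [← map_sub]
      refine (H.growth j n (x - y)).trans ?_
      gcongr
      linarith
  have hleft : ∀ n x, (x - u n x n) + v n (x - u n x n) n = x := by
    intro n x
    have h1 : ∀ j, transition A j n (x - u n x n) = orbit n x j - u n x j := by
      intro j
      have h2 := transition_eq (A := A) (y := fun j => orbit n x j - u n x j)
        (fun j => ?_) n j
      · simpa only [horbit_self] using h2
      · change orbit n x (j + 1) - greenSum A P _ (j + 1) = A j (orbit n x j - greenSum A P _ j)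
        rw [G.greenSum_succ H, horbit_succ, map_sub]
        abel
    -- Along the linear orbit just found, `u n x` satisfies the same fixed point equation as `v`.
    have h3 : v n (x - u n x n) = u n x := by
      refine G.fixedPoint_unique H hcG (y := fun j => transition A j n (x - u n x n)) (hv _ _) ?_
      simp_rw [h1, sub_add_cancel]
      rfl
    rw [h3, sub_add_cancel]
  have hright : ∀ n y, (y + v n y n) - u n (y + v n y n) n = y := by
    intro n y
    -- Adding the correction to the linear orbit gives an orbit of the nonlinear system.
    have h1 : orbit n (y + v n y n) = fun j => transition A j n y + v n y j := by
      funext j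
      have h2 := eq_nonlinearFlow (F := F) (x := fun j => transition A j n y + v n y j)
        (fun j => ?_) n j
      · simpa only [transition_self] using h2
      · rw [hF]
        conv_lhs => rw [← hv]
        rw [G.greenSum_succ H (fun j => transition A j n y + v n y j), hv, transition_succ,
          map_add]
        abel
    have h3 : u n (y + v n y n) = v n y := by
      change greenSum A P (fun j => g j (orbit n (y + v n y n) j)) = v n y
      rw [h1, hv]
    rw [h3, add_sub_cancel_right]
  have hcont : ∀ n, ∀ f : X → X, (∀ x y, p n (f x - f y) ≤ R * p n (x - y) ^ ρ) → Continuous f :=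
    fun n f hf => (H.equiv n).continuous_of_holder hρ0 hf
  let h : ℕ → X ≃ₜ X := fun n =>
    { toFun := fun x => x - u n x n
      invFun := fun y => y + v n y n
      left_inv := hleft n
      right_inv := hright n
      continuous_toFun := continuous_id.sub (hcont n _ (hu_holder n))
      continuous_invFun := continuous_id.add (hcont n _ (hv_holder n)) }
  have hh : ∀ n x, h n x = x - u n x n := fun _ _ => rfl
  have hh' : ∀ n y, (h n).symm y = y + v n y n := fun _ _ => rfl
  refine ⟨h, fun n x => ?_, ⟨greenConstant L N ν * M + 1, by positivity, fun n x => ⟨?_, ?_⟩⟩,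
    ⟨1 + R, ρ, 1, by positivity, hρ0, one_pos, fun n x y hxy => ⟨?_, ?_⟩⟩⟩
  -- The correction depends only on the orbit, not on the time that labels it, so the conjugacy
  -- relation reduces to the difference equation for the Green sum.
  · have h1 : orbit (n + 1) (A n x + g n x) = orbit n x := by
      have h2 : (nonlinearFlow F (n + 1)).symm (F n x) = (nonlinearFlow F n).symm x := by
        rw [Equiv.symm_apply_eq, nonlinearFlow_succ_apply, Equiv.apply_symm_apply]
      rw [hF] at h2
      funext j
      simp only [orbit, h2]
    have h3 : u (n + 1) (A n x + g n x) = u n x := by simp only [u, h1]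
    have h4 : u n x (n + 1) = A n (u n x n) + g n x := by
      have := G.greenSum_succ H (orbit n x) n
      rwa [horbit_self] at this
    rw [hh, hh, h3, h4, map_sub]
    abel
  · have e : h n x - x = -u n x n := by rw [hh]; abel
    rw [e, map_neg_eq_map]
    linarith [hu_le n x]
  · have e : (h n).symm x - x = v n x n := by rw [hh']; abel
    rw [e]
    linarith [hv_le n x]
  · have e : h n x - h n y = (x - y) - (u n x n - u n y n) := by rw [hh, hh]; abel
    refine le_add_mul_rpow hρ1 (apply_nonneg _ _) hxy ?_ zero_le_one
    rw [e, one_mul]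
    exact (map_sub_le_add (p n) _ _).trans (add_le_add le_rfl (hu_holder n x y))
  · have e : (h n).symm x - (h n).symm y = (x - y) + (v n x n - v n y n) := by rw [hh', hh']; abel
    refine le_add_mul_rpow hρ1 (apply_nonneg _ _) hxy ?_ zero_le_one
    rw [e, one_mul]
    exact (map_add_le_add (p n) _ _).trans (add_le_add le_rfl (hv_holder n x y))

end Conjugacy

/-! ### Translation from growth rates on `n ≥ 1` to logarithmic time on `n ≥ 0`. -/

section Evolution

open Real

variable {𝕜 X : Type*} [RCLike 𝕜] [NormedAddCommGroup X] [NormedSpace 𝕜 X]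

theorem evolution_succ_succ {A : ℕ → X →L[𝕜] X} {A' : ℕ → X ≃L[𝕜] X}
    (hA : ∀ n, (A' n : X →L[𝕜] X) = A (n + 1)) (m k : ℕ) :
    evolution A (m + 1) (k + 1) = (transition A' m k : X →L[𝕜] X) := by
  have h : ∀ k j, forwardEvolution A (k + 1) j = (transition A' (k + j) k : X →L[𝕜] X) := by
    intro k j
    induction j with
    | zero => ext x; simp [forwardEvolution, transition_self]
    | succ j ih =>
      have h1 : k + 1 + j = (k + j) + 1 := by omega
      rw [forwardEvolution, ih, h1, ← hA]
      rfl
  unfold evolution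
  split_ifs with hkm
  · have h1 : k + (m + 1 - (k + 1)) = m := by omega
    rw [h, h1]
  · have h1 : m + (k + 1 - (m + 1)) = k := by omega
    rw [h, h1, ContinuousLinearMap.inverse_equiv]
    rfl

theorem transition_apply_projection {A : ℕ → X ≃L[𝕜] X} {P : ℕ → X →L[𝕜] X}
    (h : ∀ k x, A k (P k x) = P (k + 1) (A k x)) (m k : ℕ) (x : X) :
    transition A m k (P k x) = P m (transition A m k x) := by
  have h1 : ∀ k x, linearFlow A k (P 0 x) = P k (linearFlow A k x) := by
    intro k x
    induction k with
    | zero => rfl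
    | succ k ih => rw [linearFlow_succ_apply, ih, h]; rfl
  obtain ⟨z, rfl⟩ := (linearFlow A k).surjective x
  rw [← h1, transition_apply, transition_apply, ContinuousLinearEquiv.symm_apply_apply,
    ContinuousLinearEquiv.symm_apply_apply, h1]

theorem div_rpow_eq_exp {s t : ℝ} (hs : 0 < s) (ht : 0 < t) (b : ℝ) :
    (s / t) ^ b = exp (b * (log s - log t)) := by
  rw [rpow_def_of_pos (div_pos hs ht), log_div hs.ne' ht.ne', mul_comm]

theorem exp_log_sub_log_sub_one {s t : ℝ} (hs : 0 < s) (ht : 0 < t) :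
    exp (log s - log t) - 1 = (s - t) / t := by
  rw [exp_sub, exp_log hs, exp_log ht, sub_div, div_self ht.ne']

theorem IsMuDichotomy.isHyperbolicSystem {μ : ℕ → ℝ} {p : ℕ → Seminorm 𝕜 X}
    {A P : ℕ → X →L[𝕜] X} {A' : ℕ → X ≃L[𝕜] X} {θ N ν K a : ℝ}
    (D : IsMuDichotomy μ p A N ν P) (B : HasMuBoundedGrowth μ p A K a)
    (hA : ∀ n, (A' n : X →L[𝕜] X) = A (n + 1)) (hμ : IsGrowthRate μ)
    (hμθ : ∀ n, μ (n + 1) / μ n ≤ θ) (hp : ∀ n, 1 ≤ n → IsEquivalentNorm (p n))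
    (hN : 0 ≤ N) (hν : 0 < ν) (hK : 0 ≤ K) (ha : 0 ≤ a) :
    IsHyperbolicSystem (fun n => log (μ (n + 1))) (fun n => p (n + 1)) A' (fun n => P (n + 1))
      (log θ) N ν K a := by
  have hpos := hμ.pos
  have hmono : Monotone fun n => log (μ (n + 1)) := fun m k h =>
    log_le_log (hpos _) (hμ.strictMono.monotone (Nat.succ_le_succ h))
  have hAx : ∀ n x, A' n x = A (n + 1) x := fun n x => by rw [← hA]; rfl
  have hev : ∀ m k x, evolution A (m + 1) (k + 1) x = transition A' m k x := fun m k x => by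
    rw [evolution_succ_succ hA]; rfl
  have hcomm := transition_apply_projection (A := A') (P := fun n => P (n + 1)) fun k x => by
    rw [hAx, hAx]; exact D.commute (k + 1) (by omega) x
  refine ⟨hmono, fun n => ?_, fun n => hp _ (by omega), hN, hν, hK, ha, fun m k x => ?_,
    fun m k x => ?_⟩
  · rw [← log_div (hpos _).ne' (hpos _).ne']
    exact log_le_log (div_pos (hpos _) (hpos _)) (hμθ _)
  · rcases le_total k m with h | h
    · have h1 := B.1 (m + 1) (k + 1) (by omega) (by omega) x
      rwa [hev, div_rpow_eq_exp (hpos _) (hpos _), ← abs_of_nonneg (sub_nonneg.2 (hmono h))] at h1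
    · have h1 := B.2 (m + 1) (k + 1) (by omega) (by omega) x
      rwa [hev, div_rpow_eq_exp (hpos _) (hpos _), ← abs_of_nonneg (sub_nonneg.2 (hmono h)),
        abs_sub_comm] at h1
  · unfold greenOperator
    split_ifs with h
    · have h1 := D.stable (m + 1) (k + 1) (by omega) (by omega) x
      rwa [hev, div_rpow_eq_exp (hpos _) (hpos _), ← abs_of_nonneg (sub_nonneg.2 (hmono h))] at h1
    · have h' : m ≤ k := by omega
      -- The witness must lie in the kernel of the projection at `m + 1`; this holds because
      -- projections commute with the transition maps.
      have h1 := D.unstable (m + 1) (k + 1) (by omega) (by omega) x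
        (transition A' m k (x - P (k + 1) x)) ?_ ?_
      · rw [div_rpow_eq_exp (hpos _) (hpos _), ← abs_of_nonneg (sub_nonneg.2 (hmono h')),
          abs_sub_comm] at h1
        refine le_trans (le_of_eq ?_) h1
        exact map_neg_eq_map (p (m + 1)) (transition A' m k (x - P (k + 1) x))
      · rw [← hcomm m k, map_sub, D.proj (k + 1) (by omega), sub_self, map_zero]
      · rw [hev, transition_apply, transition_apply, ContinuousLinearEquiv.symm_apply_apply,
          ContinuousLinearEquiv.apply_symm_apply]

end Evolution

/-! ### Choice of the smallness constant and return to the original indices. -/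

theorem mainTheorem3
    (θ N ν K a : ℝ) (hθ : 1 ≤ θ) (hN : 1 ≤ N) (hν : 0 < ν) (hK : 0 < K) (ha : 0 < a) :
    ∃ c₀ : ℝ, 0 < c₀ ∧
      ∀ {𝕜 X : Type*} [RCLike 𝕜] [NormedAddCommGroup X] [NormedSpace 𝕜 X] [CompleteSpace X]
        (μ : ℕ → ℝ) (p : ℕ → Seminorm 𝕜 X) (A P : ℕ → X →L[𝕜] X) (g : ℕ → X → X) (M c : ℝ),
        IsGrowthRate μ →
        (∀ n, μ (n + 1) / μ n ≤ θ) →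
        (∀ n, 1 ≤ n → IsEquivalentNorm (p n)) →
        (∀ n, 1 ≤ n → (A n).IsInvertible) →
        IsMuDichotomy μ p A N ν P →
        HasMuBoundedGrowth μ p A K a →
        0 < M →
        (∀ n, 1 ≤ n → ∀ x, p (n + 1) (g n x) ≤ M * ((μ (n + 1) - μ n) / μ n)) →
        0 < c → c ≤ c₀ →
        (∀ n, 1 ≤ n → ∀ x y,
          p (n + 1) (g n x - g n y) ≤ c * ((μ (n + 1) - μ n) / μ n) * p n (x - y)) →
        ∃ h : ℕ → X ≃ₜ X,
          (∀ n, 1 ≤ n → ∀ x, h (n + 1) (A n x + g n x) = A n (h n x)) ∧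
          (∃ D : ℝ, 0 < D ∧ ∀ n, 1 ≤ n → ∀ x,
            p n (h n x - x) ≤ D ∧ p n ((h n).symm x - x) ≤ D) ∧
          (∃ K' ρ δ : ℝ, 0 < K' ∧ 0 < ρ ∧ 0 < δ ∧
            ∀ n, 1 ≤ n → ∀ x y, p n (x - y) ≤ δ →
              p n (h n x - h n y) ≤ K' * p n (x - y) ^ ρ ∧
              p n ((h n).symm x - (h n).symm y) ≤ K' * p n (x - y) ^ ρ) := by
  have hκ : 0 < greenConstant (Real.log θ) N ν := by
    unfold greenConstant
    positivity
  set κ := greenConstant (Real.log θ) N ν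
  set E := Real.exp ((a + 1) * Real.log θ)
  have hE : 0 < E := Real.exp_pos _
  -- The first bound makes the fixed point map a contraction with factor 1/2; the second serves the
  -- Gronwall inequalities and the bijectivity of `A n + g n`.
  refine ⟨min (1 / 2 / κ) (1 / (K * E)), by positivity, ?_⟩
  intro 𝕜 X _ _ _ _ μ p A P g M c hμ hμθ hp hA hD hB hM hgM hc hcc hg
  choose A' hA' using fun n => hA (n + 1) (by omega)
  have hAx : ∀ n x, A' n x = A (n + 1) x := fun n x => by rw [← hA']; rfl
  have H := hD.isHyperbolicSystem hB hA' hμ hμθ hp (by linarith) hν hK.le ha.le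
  have hδ : ∀ n, Real.exp (Real.log (μ (n + 1)) - Real.log (μ n)) - 1 = (μ (n + 1) - μ n) / μ n :=
    fun n => exp_log_sub_log_sub_one (hμ.pos _) (hμ.pos _)
  have G : IsSmallPerturbation (fun n => Real.log (μ (n + 1))) (fun n => p (n + 1))
      (fun n => g (n + 1)) M c := by
    refine ⟨hM.le, hc.le, fun n x => ?_, fun n x y => ?_⟩
    · rw [hδ, mul_comm]; exact hgM (n + 1) (by omega) x
    · rw [hδ]; exact hg (n + 1) (by omega) x y
  have hcG : κ * c ≤ 1 / 2 := by
    rw [mul_comm, ← le_div_iff₀ hκ]; exact hcc.trans (min_le_left _ _)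
  have hKc : K * c * E ≤ 1 := by
    have := hcc.trans (min_le_right _ _)
    rw [le_div_iff₀ (by positivity)] at this
    linarith
  obtain ⟨h, h1, ⟨D, hD0, h2⟩, C, ρ, δ, hC, hρ, hδ0, h3⟩ := G.exists_conjugacy H hcG hKc
  -- The index shift is undone; the value at `n = 0` is arbitrary, since only `n ≥ 1` matters.
  refine ⟨fun n => h (n - 1), ?_, ⟨D, hD0, ?_⟩, C, ρ, δ, hC, hρ, hδ0, ?_⟩
  · intro n hn x
    obtain ⟨n, rfl⟩ := Nat.exists_eq_add_of_le' hn
    have := h1 n x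
    rwa [hAx, hAx] at this
  · intro n hn x
    obtain ⟨n, rfl⟩ := Nat.exists_eq_add_of_le' hn
    exact h2 n x
  · intro n hn x y
    obtain ⟨n, rfl⟩ := Nat.exists_eq_add_of_le' hn
    exact h3 n x y
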